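/- Let $\Gamma$ be a finite simple connected graph of diameter $D\ge 3$ that is isomorphic to one of the following: (i) a Hamming graph $H(d,q)$ (vertices: words of length $d$ over an alphabet of size $q$; adjacency: differing in exactly one coordinate), or a Doob graph (the Cartesian product of $s\ge 1$ copies of the Shrikhande graph and $t\ge 0$ copies of the complete graph $K_4$, where the Shrikhande graph is the Cayley graph of $\mathbb{Z}_4\times\mathbb{Z}_4$ with connection set $\{\pm(1,0),\pm(0,1),\pm(1,1)\}$); (ii) a Johnson graph $J(n,k)$ (vertices: the $k$-subsets of an $n$-set; adjacency: meeting in exactly $k-1$ elements); (iii) a halved cube (vertices: the binary words of length $n$ and even weight; adjacency: being at Hamming distance $2$); (iv) the Gosset graph (vertices: two copies of the edge set of $K_8$; two vertices from the same copy are adjacent if and only if the edges share exactly one endpoint, two vertices from different copies if and only if the edges are disjoint). Then the distance matrix $\mathbb{D}=(d(x,y))_{x,y\in V(\Gamma)}$ of $\Gamma$, where $d(x,y)$ is the length of a shortest path between $x$ and $y$, has exactly three distinct eigenvalues, and one of them is $0$. -/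

import Mathlib

namespace DistanceSpectra

/-- The distance matrix of a finite graph: the `(x, y)` entry is the graph distance `d(x, y)`. -/
noncomputable def distanceMatrix {V : Type*} (G : SimpleGraph V) : Matrix V V ℝ :=
  Matrix.of fun x y => (G.dist x y : ℝ)

/-- The set of distance eigenvalues of a finite graph, i.e. of eigenvalues of its distance matrix
(a real symmetric matrix, so that all its eigenvalues are real). -/
def distanceEigenvalues {V : Type*} [Fintype V] (G : SimpleGraph V) : Set ℝ :=
  {μ : ℝ | Module.End.HasEigenvalue (distanceMatrix G).mulVecLin μ}

/-- The Cartesian product of `n` copies of `G`: two `n`-tuples are adjacent if they agree in all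
coordinates but one, and are adjacent in `G` at that coordinate. -/
def cartesianPower {V : Type*} (G : SimpleGraph V) (n : ℕ) : SimpleGraph (Fin n → V) where
  Adj x y := ∃ i, G.Adj (x i) (y i) ∧ ∀ j, j ≠ i → x j = y j
  symm := ⟨fun _ _ ⟨i, h, h'⟩ => ⟨i, h.symm, fun j hj => (h' j hj).symm⟩⟩
  loopless := ⟨fun _ ⟨_, h, _⟩ => h.ne rfl⟩

/-- The Hamming graph `H(d, q)`: words of length `d` over an alphabet with `q` letters, two words
being adjacent if they differ in exactly one coordinate. -/
def hammingGraph (d q : ℕ) : SimpleGraph (Fin d → Fin q) where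
  Adj x y := hammingDist x y = 1
  symm := ⟨fun x y h => by rwa [hammingDist_comm]⟩
  loopless := ⟨fun x h => by simp at h⟩

/-- The Shrikhande graph: the Cayley graph of `ℤ/4 × ℤ/4` with connection set
`{±(1,0), ±(0,1), ±(1,1)}`. -/
def shrikhandeGraph : SimpleGraph (ZMod 4 × ZMod 4) :=
  SimpleGraph.circulantGraph {(1, 0), (0, 1), (1, 1)}

/-- The Doob graph `D(s, t)`: the Cartesian product of `s` copies of the Shrikhande graph and
`t` copies of the complete graph `K₄` (the latter forming `H(t, 4)`). It is called a Doob graph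
when `s ≥ 1`. -/
def doobGraph (s t : ℕ) : SimpleGraph ((Fin s → ZMod 4 × ZMod 4) × (Fin t → Fin 4)) :=
  (cartesianPower shrikhandeGraph s).boxProd (hammingGraph t 4)

/-- The Johnson graph `J(n, k)`: the `k`-subsets of an `n`-set, two of them being adjacent if they
meet in exactly `k - 1` elements. -/
def johnsonGraph (n k : ℕ) : SimpleGraph {S : Finset (Fin n) // S.card = k} where
  Adj S T := (S.1 ∩ T.1).card + 1 = k
  symm := ⟨fun S T h => by rwa [Finset.inter_comm]⟩
  loopless := ⟨fun S h => by have := S.2; simp at h; omega⟩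

/-- The halved `n`-cube: binary words of length `n` and even weight, two of them being adjacent if
they are at Hamming distance `2`. -/
def halvedCube (n : ℕ) : SimpleGraph {x : Fin n → ZMod 2 // Even (hammingNorm x)} where
  Adj x y := hammingDist x.1 y.1 = 2
  symm := ⟨fun x y h => by rwa [hammingDist_comm]⟩
  loopless := ⟨fun x h => by simp at h⟩

/-- The Gosset graph, on two copies of the edge set of `K₈`: vertices from the same copy are
adjacent if the edges share exactly one endpoint, vertices from different copies are adjacent if
the edges are disjoint. -/
def gossetGraph : SimpleGraph (Bool × {e : Finset (Fin 8) // e.card = 2}) where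
  Adj u v := (u.1 = v.1 ∧ (u.2.1 ∩ v.2.1).card = 1) ∨ (u.1 ≠ v.1 ∧ Disjoint u.2.1 v.2.1)
  symm := ⟨fun u v h => by
    rcases h with ⟨h, h'⟩ | ⟨h, h'⟩
    · exact Or.inl ⟨h.symm, by rwa [Finset.inter_comm]⟩
    · exact Or.inr ⟨h.symm, h'.symm⟩⟩
  loopless := ⟨fun u h => by
    rcases h with ⟨_, h⟩ | ⟨h, _⟩
    · have := u.2.2; simp at h; omega
    · exact h rfl⟩

/-- `G` is (isomorphic to) a Hamming graph. -/
def IsHammingGraph {V : Type*} (G : SimpleGraph V) : Prop :=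
  ∃ d q : ℕ, Nonempty (G ≃g hammingGraph d q)

/-- `G` is (isomorphic to) a Doob graph. -/
def IsDoobGraph {V : Type*} (G : SimpleGraph V) : Prop :=
  ∃ s t : ℕ, 1 ≤ s ∧ Nonempty (G ≃g doobGraph s t)

/-- `G` is (isomorphic to) a Johnson graph. -/
def IsJohnsonGraph {V : Type*} (G : SimpleGraph V) : Prop :=
  ∃ n k : ℕ, Nonempty (G ≃g johnsonGraph n k)

/-- `G` is (isomorphic to) a halved cube. -/
def IsHalvedCube {V : Type*} (G : SimpleGraph V) : Prop :=
  ∃ n : ℕ, Nonempty (G ≃g halvedCube n)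

/-- `G` is (isomorphic to) the Gosset graph. -/
def IsGossetGraph {V : Type*} (G : SimpleGraph V) : Prop :=
  Nonempty (G ≃g gossetGraph)

end DistanceSpectra

namespace DistanceSpectra

/-! Everything rests on one identity: in each family the distance matrix `A` has constant row sum
`k` and satisfies `A² + θA = rJ` with `θ > 0`. On vectors of sum zero this reads `A(A + θ) = 0`, so
only `0`, `-θ` and `k` can be eigenvalues. All three occur once the diameter is at least 3: `k`
through the all-ones vector, the others through explicit vectors built from columns of `A`
(`IsQuadraticKernel.ncard_distanceEigenvalues`).

The identity has two sources. Distances add over Cartesian products, and the identity survives when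
`θ = c|V|` with the same `c` in every factor (`IsQuadraticKernel.prod`). `K_q` has `c = 1/q` and the
Shrikhande graph has `c = 4/16`, the value for `K₄`; this covers Hamming and Doob graphs. In the
other families `A = cJ - sMMᵀ`, where `M` lists the vertices as vectors and `MᵀM = aI + bJ`
(`isQuadraticKernel_of_gram`): indicator vectors for Johnson graphs, sign vectors for halved cubes,
and 56 vectors `±(3,3,-1,…,-1)`, up to order of coordinates, for the Gosset graph. -/

/-- A symmetric kernel with constant row sums, of which the matrix `A` satisfies
`A² + θ A = r J` for some `r`, where `J` is the all-ones matrix. -/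
structure IsQuadraticKernel {V : Type*} [Fintype V] (θ : ℝ) (δ : V → V → ℝ) : Prop where
  symm : ∀ x y, δ x y = δ y x
  row : ∃ k, ∀ x, ∑ y, δ x y = k
  quad : ∃ r, ∀ x y, ∑ z, δ x z * δ z y + θ * δ x y = r

/-! ### Spectrum from the quadratic identity -/

theorem mem_distanceEigenvalues_iff {V : Type*} [Fintype V] {G : SimpleGraph V} {μ : ℝ} :
    μ ∈ distanceEigenvalues G ↔
      ∃ v : V → ℝ, v ≠ 0 ∧ ∀ x, ∑ y, (G.dist x y : ℝ) * v y = μ * v x := by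
  constructor
  · intro h
    obtain ⟨v, hv⟩ := Module.End.HasEigenvalue.exists_hasEigenvector h
    refine ⟨v, hv.2, fun x => ?_⟩
    have := congrFun hv.apply_eq_smul x
    simpa [Matrix.mulVec, dotProduct, distanceMatrix] using this
  · rintro ⟨v, hv, h⟩
    refine Module.End.hasEigenvalue_of_hasEigenvector (x := v)
      ⟨Module.End.mem_eigenspace_iff.2 (funext fun x => ?_), hv⟩
    simpa [Matrix.mulVec, dotProduct, distanceMatrix] using h x

/-- The distance spectrum of a graph of diameter at least `3` whose distance matrix satisfies
`A² + θ A = r J` consists of `0`, `-θ` and the common row sum. -/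
theorem IsQuadraticKernel.ncard_distanceEigenvalues {V : Type*} [Fintype V] {G : SimpleGraph V}
    {θ : ℝ} (hθ : 0 < θ) (h : IsQuadraticKernel θ fun x y => (G.dist x y : ℝ))
    (hD : 3 ≤ G.diam) :
    (distanceEigenvalues G).ncard = 3 ∧ (0 : ℝ) ∈ distanceEigenvalues G := by
  classical
  have : Nontrivial V := SimpleGraph.nontrivial_of_diam_ne_zero (G := G) (by omega)
  have hconn : G.Connected := by
    by_contra hc
    have := SimpleGraph.diam_eq_zero_of_not_connected hc
    omega
  obtain ⟨a, b, hab⟩ := G.exists_dist_eq_diam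
  obtain ⟨c, hac⟩ : ∃ c, G.Adj a c := hconn.preconnected.exists_adj_of_nontrivial a
  have hb : 3 ≤ G.dist a b := by omega
  have hc : G.dist a c = 1 := SimpleGraph.dist_eq_one_iff_adj.2 hac
  have hba : b ≠ a := by rintro rfl; simp at hb
  obtain ⟨hs, ⟨k, hk⟩, r, hr⟩ := h
  have hkpos : 0 < k := by
    rw [← hk a]
    refine Finset.sum_pos' (fun _ _ => by positivity) ⟨c, Finset.mem_univ _, ?_⟩
    rw [hc]; norm_num
  have mem_k : k ∈ distanceEigenvalues G := by
    refine mem_distanceEigenvalues_iff.2 ⟨fun _ => 1, ?_, fun x => by simpa using hk x⟩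
    exact fun h0 => one_ne_zero (congrFun h0 a)
  have mem_θ : -θ ∈ distanceEigenvalues G := by
    -- A difference of two columns: `J` kills `e_a - e_b`, so `A² = -θA` on it.
    refine mem_distanceEigenvalues_iff.2 ⟨fun z => G.dist z a - G.dist z b, ?_, fun x => ?_⟩
    · intro h0
      have := congrFun h0 a
      simp only [SimpleGraph.dist_self, Nat.cast_zero, zero_sub, Pi.zero_apply, neg_eq_zero,
        Nat.cast_eq_zero] at this
      omega
    · simp only [mul_sub, Finset.sum_sub_distrib]
      linarith [hr x a, hr x b]
  have mem_zero : (0 : ℝ) ∈ distanceEigenvalues G := by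
    -- The vector is `(A + θ)e_a - (r/k)1`; applying `A` gives `r1 - r1 = 0`. If it vanished, its
    -- entries at `b` and `c` would force `d(a,b) = r/k = d(a,c) = 1`.
    refine mem_distanceEigenvalues_iff.2
      ⟨fun z => G.dist z a + θ * (if z = a then 1 else 0) - r / k, ?_, fun x => ?_⟩
    · intro h0
      have h1 := congrFun h0 b
      have h2 := congrFun h0 c
      simp only [hba, hac.ne', if_false, mul_zero, add_zero, Pi.zero_apply,
        G.dist_comm (v := a), hc] at h1 h2
      have : (G.dist a b : ℝ) = 1 := by push_cast at h2; linarith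
      have : G.dist a b = 1 := by exact_mod_cast this
      omega
    · simp only [mul_sub, mul_add, Finset.sum_sub_distrib, Finset.sum_add_distrib, zero_mul]
      rw [← Finset.sum_mul, hk x, mul_div_cancel₀ _ hkpos.ne']
      simp only [mul_ite, mul_one, mul_zero, Finset.sum_ite_eq', Finset.mem_univ, if_true]
      linarith [hr x a]
  have key : distanceEigenvalues G = {0, -θ, k} := by
    ext μ
    simp only [Set.mem_insert_iff, Set.mem_singleton_iff]
    refine ⟨fun hμ => ?_, by rintro (rfl | rfl | rfl) <;> assumption⟩
    obtain ⟨v, hv0, hv⟩ := mem_distanceEigenvalues_iff.1 hμ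
    -- Symmetry makes the column sums `k` too, so summing the eigenvalue equation gives `μ = k`
    -- unless `v` has sum zero.
    have hsum : k * ∑ y, v y = μ * ∑ y, v y := by
      calc k * ∑ y, v y = ∑ y, (∑ x, (G.dist x y : ℝ)) * v y := by
            rw [Finset.mul_sum]
            refine Finset.sum_congr rfl fun y _ => ?_
            rw [← hk y]
            exact congrArg (· * v y) (Finset.sum_congr rfl fun x _ => hs y x)
        _ = ∑ x, ∑ y, (G.dist x y : ℝ) * v y := by
            simp only [Finset.sum_mul]; exact Finset.sum_comm
        _ = μ * ∑ y, v y := by simp only [hv, Finset.mul_sum]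
    by_cases hS : ∑ y, v y = 0
    · obtain ⟨x, hx⟩ := Function.ne_iff.1 hv0
      have h2 : ∑ y, (∑ z, (G.dist x z : ℝ) * G.dist z y) * v y = μ * (μ * v x) := by
        simp only [Finset.sum_mul]
        rw [Finset.sum_comm]
        simp only [mul_assoc, ← Finset.mul_sum, hv]
        rw [← hv x, Finset.mul_sum]
        exact Finset.sum_congr rfl fun _ _ => by ring
      have h3 : ∑ y, (∑ z, (G.dist x z : ℝ) * G.dist z y + θ * G.dist x y) * v y = 0 := by
        simp only [hr, ← Finset.mul_sum, hS, mul_zero]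
      simp only [add_mul, Finset.sum_add_distrib, h2, mul_assoc, ← Finset.mul_sum, hv] at h3
      have h4 : μ * (μ + θ) * v x = 0 := by linarith
      rcases mul_eq_zero.1 ((mul_eq_zero.1 h4).resolve_right hx) with h | h
      · exact Or.inl h
      · exact Or.inr (Or.inl (by linarith))
    · exact Or.inr (Or.inr (mul_right_cancel₀ hS hsum).symm)
  refine ⟨?_, mem_zero⟩
  rw [key, Set.ncard_eq_three]
  exact ⟨0, -θ, k, by linarith, hkpos.ne, by linarith, rfl⟩

/-! ### Isomorphism invariance and recognition of the distance -/

theorem IsQuadraticKernel.comp_equiv {V W : Type*} [Fintype V] [Fintype W] {θ : ℝ}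
    {δ : V → V → ℝ} (h : IsQuadraticKernel θ δ) (e : W ≃ V) :
    IsQuadraticKernel θ fun x y => δ (e x) (e y) := by
  obtain ⟨hs, ⟨k, hk⟩, r, hr⟩ := h
  refine ⟨fun x y => hs _ _, ⟨k, fun x => ?_⟩, r, fun x y => ?_⟩
  · rw [e.sum_comp fun y => δ (e x) y, hk]
  · rw [e.sum_comp fun z => δ (e x) z * δ z (e y), hr]

theorem dist_apply_iso {V W : Type*} {G : SimpleGraph V} {H : SimpleGraph W} (e : G ≃g H)
    (x y : V) : H.dist (e x) (e y) = G.dist x y := by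
  rw [SimpleGraph.dist, SimpleGraph.dist]
  congr 1
  refine le_antisymm (le_iInf fun p => ?_) (le_iInf fun p => ?_)
  · simpa using SimpleGraph.edist_le (p.map e.toHom)
  · have := SimpleGraph.edist_le (p.map e.symm.toHom)
    simpa using this

theorem IsQuadraticKernel.ncard_distanceEigenvalues_of_iso {V W : Type*} [Fintype V] [Fintype W]
    {G : SimpleGraph V} {H : SimpleGraph W} (e : G ≃g H) {θ : ℝ} (hθ : 0 < θ)
    (h : IsQuadraticKernel θ fun x y => (H.dist x y : ℝ)) (hD : 3 ≤ G.diam) :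
    (distanceEigenvalues G).ncard = 3 ∧ (0 : ℝ) ∈ distanceEigenvalues G := by
  refine IsQuadraticKernel.ncard_distanceEigenvalues hθ ?_ hD
  simpa only [RelIso.coe_fn_toEquiv, dist_apply_iso] using h.comp_equiv e.toEquiv

/-- A function that changes by at most one along edges, and decreases along some edge wherever it
does not vanish, is the graph distance. -/
theorem reachable_and_dist_eq {V : Type*} {G : SimpleGraph V} (f : V → V → ℕ)
    (h0 : ∀ x, f x x = 0) (hle : ∀ x y z, G.Adj y z → f x z ≤ f x y + 1)
    (hex : ∀ x y, x ≠ y → ∃ z, G.Adj z y ∧ f x z + 1 = f x y) (x y : V) :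
    G.Reachable x y ∧ G.dist x y = f x y := by
  -- Descending along `hex` builds a walk of length `f x y`; where `f x y = 0`, `hex` cannot apply,
  -- so `x = y`.
  have key : ∀ n y, f x y = n → ∃ p : G.Walk x y, p.length = n := by
    intro n
    induction n with
    | zero =>
      intro y hy
      by_cases hxy : x = y
      · subst hxy; exact ⟨.nil, rfl⟩
      · obtain ⟨z, _, hz⟩ := hex x y hxy
        omega
    | succ n ih =>
      intro y hy
      have hxy : x ≠ y := by rintro rfl; rw [h0] at hy; omega
      obtain ⟨z, hz, hf⟩ := hex x y hxy
      obtain ⟨p, hp⟩ := ih z (by omega)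
      exact ⟨p.concat hz, by simp [hp]⟩
  obtain ⟨p, hp⟩ := key _ y rfl
  refine ⟨p.reachable, le_antisymm (hp ▸ SimpleGraph.dist_le p) ?_⟩
  obtain ⟨q, hq⟩ := p.reachable.exists_walk_length_eq_dist
  rw [← hq]
  clear hq hp p
  have aux : ∀ {u v : V} (q : G.Walk u v), f x v ≤ f x u + q.length := by
    intro u v q
    induction q with
    | nil => simp
    | cons hadj q ih =>
      have := hle x _ _ hadj
      simp only [SimpleGraph.Walk.length_cons]
      omega
  simpa [h0] using aux q


/-! ### Cartesian products: Hamming and Doob graphs -/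

/-- The matrix is `A ⊗ J + J ⊗ B`. The cross terms are multiples of `J` because row sums are
constant, while `(A ⊗ J)² = |W| A² ⊗ J`. The factor `|W|` turns `c|V|` into `c|V||W|`, and
symmetrically for `B`. -/
theorem IsQuadraticKernel.prod {V W : Type*} [Fintype V] [Fintype W] {c : ℝ}
    {a : V → V → ℝ} {b : W → W → ℝ}
    (ha : IsQuadraticKernel (c * Fintype.card V) a)
    (hb : IsQuadraticKernel (c * Fintype.card W) b) :
    IsQuadraticKernel (c * Fintype.card (V × W)) fun x y : V × W => a x.1 y.1 + b x.2 y.2 := by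
  obtain ⟨hs, ⟨k, hk⟩, r, hr⟩ := ha
  obtain ⟨hs', ⟨k', hk'⟩, r', hr'⟩ := hb
  have hc : ∀ y, ∑ x, a x y = k := fun y => by simpa only [hs _ y] using hk y
  have hc' : ∀ y, ∑ x, b x y = k' := fun y => by simpa only [hs' _ y] using hk' y
  refine ⟨fun x y => by rw [hs, hs'], ⟨Fintype.card W * k + Fintype.card V * k', fun x => ?_⟩,
    Fintype.card W * r + Fintype.card V * r' + 2 * (k * k'), fun x y => ?_⟩
  · simp only [Fintype.sum_prod_type, Finset.sum_add_distrib, Finset.sum_const, Finset.card_univ,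
      nsmul_eq_mul, ← Finset.mul_sum, hk, hk']
  · simp only [Fintype.sum_prod_type, mul_add, add_mul, Finset.sum_add_distrib, Finset.sum_const,
      Finset.card_univ, nsmul_eq_mul, ← Finset.mul_sum, ← Finset.sum_mul, hk, hk', hc, hc',
      Fintype.card_prod, Nat.cast_mul]
    rw [← hr x.1 y.1, ← hr' x.2 y.2]
    ring

theorem IsQuadraticKernel.pi {V : Type*} [Fintype V] {c : ℝ} {a : V → V → ℝ}
    (ha : IsQuadraticKernel (c * Fintype.card V) a) (n : ℕ) :
    IsQuadraticKernel (c * Fintype.card (Fin n → V)) fun x y : Fin n → V => ∑ i, a (x i) (y i) := by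
  induction n with
  | zero => exact ⟨by simp, ⟨0, by simp⟩, 0, by simp⟩
  | succ n ih =>
    have h := (ha.prod ih).comp_equiv (Fin.consEquiv fun _ : Fin (n + 1) => V).symm
    rw [Fintype.card_congr (Fin.consEquiv fun _ : Fin (n + 1) => V)] at h
    convert h using 3 with x y
    rw [Fin.sum_univ_succ]
    rfl

theorem isQuadraticKernel_ne {V : Type*} [Fintype V] [DecidableEq V] :
    IsQuadraticKernel 1 fun x y : V => if x = y then (0 : ℝ) else 1 := by
  have h : ∀ x y : V, (if x = y then (0 : ℝ) else 1) = 1 - if x = y then 1 else 0 := by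
    intro x y; split_ifs <;> norm_num
  simp only [h]
  refine ⟨fun x y => by simp only [eq_comm], ⟨Fintype.card V - 1, fun x => ?_⟩,
    Fintype.card V - 1, fun x y => ?_⟩
  · simp [Finset.sum_sub_distrib]
  · simp [mul_sub, Finset.sum_sub_distrib]

theorem dist_hammingGraph {d q : ℕ} (x y : Fin d → Fin q) :
    (hammingGraph d q).Reachable x y ∧ (hammingGraph d q).dist x y = hammingDist x y := by
  refine reachable_and_dist_eq hammingDist hammingDist_self (fun x y z h => ?_)
    (fun x y h => ?_) x y
  · have h' : hammingDist y z = 1 := h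
    rw [← h']
    exact hammingDist_triangle x y z
  · obtain ⟨i, hi⟩ := Function.ne_iff.1 h
    have h1 : Finset.univ.filter (fun j => x j ≠ y j) =
        insert i (Finset.univ.filter fun j => x j ≠ Function.update y i (x i) j) := by
      ext j
      by_cases hj : j = i
      · subst hj; simpa using hi
      · simp [hj]
    refine ⟨Function.update y i (x i), ?_, ?_⟩
    · change hammingDist _ _ = 1
      unfold hammingDist
      rw [Finset.card_eq_one]
      refine ⟨i, ?_⟩
      ext j
      by_cases hj : j = i
      · subst hj; simpa using hi
      · simp [hj]
    · unfold hammingDist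
      rw [h1, Finset.card_insert_of_notMem (by simp)]

theorem isQuadraticKernel_dist_hammingGraph {d q : ℕ} (hq : q ≠ 0) :
    IsQuadraticKernel ((q : ℝ)⁻¹ * Fintype.card (Fin d → Fin q))
      fun x y => ((hammingGraph d q).dist x y : ℝ) := by
  have h : IsQuadraticKernel ((q : ℝ)⁻¹ * Fintype.card (Fin q))
      fun x y : Fin q => if x = y then (0 : ℝ) else 1 := by
    rw [Fintype.card_fin, inv_mul_cancel₀ (by exact_mod_cast hq)]
    exact isQuadraticKernel_ne
  convert h.pi d using 3 with x y
  rw [(dist_hammingGraph x y).2, hammingDist, Finset.card_filter, Nat.cast_sum]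
  refine Finset.sum_congr rfl fun i _ => ?_
  by_cases hi : x i = y i <;> simp [hi]

theorem exists_adj_dist_add_one_eq {V : Type*} {G : SimpleGraph V} (hG : G.Connected) {x y : V}
    (h : x ≠ y) : ∃ z, G.Adj z y ∧ G.dist x z + 1 = G.dist x y := by
  -- The geodesic runs from `y` so that its first step exposes a neighbour of `y`.
  obtain ⟨p, hp⟩ := hG.exists_walk_length_eq_dist y x
  cases p with
  | nil => exact absurd rfl h
  | @cons _ z _ hadj p =>
    refine ⟨z, hadj.symm, ?_⟩
    rw [SimpleGraph.Walk.length_cons, G.dist_comm] at hp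
    have h1 := SimpleGraph.dist_le p
    rw [G.dist_comm] at h1
    have h2 : G.dist x y ≤ G.dist x z + G.dist z y := hG.dist_triangle
    rw [SimpleGraph.dist_eq_one_iff_adj.2 hadj.symm] at h2
    omega

theorem dist_cartesianPower {V : Type*} {G : SimpleGraph V} (hG : G.Connected) {n : ℕ}
    (x y : Fin n → V) : (cartesianPower G n).Reachable x y ∧
      (cartesianPower G n).dist x y = ∑ i, G.dist (x i) (y i) := by
  refine reachable_and_dist_eq (fun x y => ∑ i, G.dist (x i) (y i)) (by simp)
    (fun x y z h => ?_) (fun x y h => ?_) x y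
  · obtain ⟨i, hi, hj⟩ := h
    have h1 : G.dist (x i) (z i) ≤ G.dist (x i) (y i) + 1 := by
      rw [← SimpleGraph.dist_eq_one_iff_adj.2 hi]
      exact hG.dist_triangle
    change ∑ i, G.dist (x i) (z i) ≤ ∑ i, G.dist (x i) (y i) + 1
    rw [← Finset.add_sum_erase _ _ (Finset.mem_univ i),
      ← Finset.add_sum_erase _ _ (Finset.mem_univ i)]
    have h2 : ∑ j ∈ Finset.univ.erase i, G.dist (x j) (z j) =
        ∑ j ∈ Finset.univ.erase i, G.dist (x j) (y j) :=
      Finset.sum_congr rfl fun j hj' => by rw [hj j (Finset.ne_of_mem_erase hj')]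
    omega
  · obtain ⟨i, hi⟩ := Function.ne_iff.1 h
    obtain ⟨z, hz, hd⟩ := exists_adj_dist_add_one_eq hG hi
    refine ⟨Function.update y i z, ⟨i, by simpa using hz, fun j hj => by simp [hj]⟩, ?_⟩
    change ∑ j, G.dist (x j) (Function.update y i z j) + 1 = ∑ j, G.dist (x j) (y j)
    rw [← Finset.add_sum_erase _ _ (Finset.mem_univ i),
      ← Finset.add_sum_erase _ (fun j => G.dist (x j) (y j)) (Finset.mem_univ i)]
    have h2 : ∑ j ∈ Finset.univ.erase i, G.dist (x j) (Function.update y i z j) =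
        ∑ j ∈ Finset.univ.erase i, G.dist (x j) (y j) :=
      Finset.sum_congr rfl fun j hj' => by
        rw [Function.update_of_ne (Finset.ne_of_mem_erase hj')]
    rw [h2, Function.update_self]
    omega

theorem dist_boxProd {V W : Type*} {G : SimpleGraph V} {H : SimpleGraph W} {x y : V × W}
    (hG : G.Reachable x.1 y.1) (hH : H.Reachable x.2 y.2) :
    (G.boxProd H).dist x y = G.dist x.1 y.1 + H.dist x.2 y.2 := by
  have h : ((G.boxProd H).dist x y : ℕ∞) = G.dist x.1 y.1 + H.dist x.2 y.2 := by
    rw [(SimpleGraph.reachable_boxProd.2 ⟨hG, hH⟩).coe_dist_eq_edist, hG.coe_dist_eq_edist,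
      hH.coe_dist_eq_edist, SimpleGraph.edist_boxProd]
  exact_mod_cast h

/-- The distance from `0` in the Shrikhande graph. -/
def shrikhandeNorm (w : ZMod 4 × ZMod 4) : ℕ :=
  if w = 0 then 0 else
    if w ∈ ({(1, 0), (0, 1), (1, 1), (3, 0), (0, 3), (3, 3)} : Finset (ZMod 4 × ZMod 4)) then 1
    else 2

theorem shrikhandeGraph_adj_iff (x y : ZMod 4 × ZMod 4) :
    shrikhandeGraph.Adj x y ↔ shrikhandeNorm (x - y) = 1 := by
  have key : ∀ w : ZMod 4 × ZMod 4, (w ≠ 0 ∧ ((w = (1, 0) ∨ w = (0, 1) ∨ w = (1, 1)) ∨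
      (-w = (1, 0) ∨ -w = (0, 1) ∨ -w = (1, 1)))) ↔ shrikhandeNorm w = 1 := by decide
  rw [← key, neg_sub]
  simp [shrikhandeGraph, sub_eq_zero]

theorem dist_shrikhandeGraph (x y : ZMod 4 × ZMod 4) :
    shrikhandeGraph.Reachable x y ∧ shrikhandeGraph.dist x y = shrikhandeNorm (x - y) := by
  refine reachable_and_dist_eq (fun x y => shrikhandeNorm (x - y)) (by simp [shrikhandeNorm])
    (fun x y z h => ?_) (fun x y h => ?_) x y
  · have key : ∀ u v : ZMod 4 × ZMod 4, shrikhandeNorm v = 1 →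
        shrikhandeNorm (u + v) ≤ shrikhandeNorm u + 1 := by decide
    have := key (x - y) (y - z) ((shrikhandeGraph_adj_iff _ _).1 h)
    rwa [sub_add_sub_cancel] at this
  · have key : ∀ u : ZMod 4 × ZMod 4, u ≠ 0 → ∃ v, shrikhandeNorm v = 1 ∧
        shrikhandeNorm (u - v) + 1 = shrikhandeNorm u := by decide
    obtain ⟨v, hv, hu⟩ := key (x - y) (sub_ne_zero.2 h)
    refine ⟨y + v, (shrikhandeGraph_adj_iff _ _).2 (by simpa using hv), ?_⟩
    rwa [← sub_sub]

/-- By translation invariance both conditions are finite checks on `ℤ/4 × ℤ/4`. There are 6 elements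
of norm 1 and 9 of norm 2, whence `24 = 6 + 18` and, at `w = 0`, `42 = 6 + 36`. -/
theorem isQuadraticKernel_dist_shrikhandeGraph :
    IsQuadraticKernel 4 fun x y => (shrikhandeGraph.dist x y : ℝ) := by
  have hrow : ∑ z, shrikhandeNorm z = 24 := by decide
  have hquad : ∀ w, ∑ z, shrikhandeNorm z * shrikhandeNorm (w - z) + 4 * shrikhandeNorm w = 42 := by
    decide
  refine ⟨fun x y => by rw [SimpleGraph.dist_comm], ⟨24, fun x => ?_⟩, 42, fun x y => ?_⟩
  · simp only [(dist_shrikhandeGraph _ _).2]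
    rw [show ∑ y, (shrikhandeNorm (x - y) : ℝ) = ∑ z, (shrikhandeNorm z : ℝ) from
      (Equiv.subLeft x).sum_comp fun z => (shrikhandeNorm z : ℝ)]
    exact_mod_cast hrow
  · simp only [(dist_shrikhandeGraph _ _).2]
    rw [← (Equiv.subLeft x).sum_comp fun z =>
      (shrikhandeNorm (x - z) : ℝ) * shrikhandeNorm (z - y)]
    have := hquad (x - y)
    simp only [Equiv.subLeft_apply, sub_sub_cancel, sub_right_comm]
    exact_mod_cast this

theorem isQuadraticKernel_dist_doobGraph (s t : ℕ) :
    IsQuadraticKernel ((4 : ℝ)⁻¹ * Fintype.card ((Fin s → ZMod 4 × ZMod 4) × (Fin t → Fin 4)))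
      fun x y => ((doobGraph s t).dist x y : ℝ) := by
  have hcard : Fintype.card (ZMod 4 × ZMod 4) = 16 := rfl
  have h : IsQuadraticKernel ((4 : ℝ)⁻¹ * Fintype.card (ZMod 4 × ZMod 4))
      fun x y => (shrikhandeGraph.dist x y : ℝ) := by
    rw [hcard]
    convert isQuadraticKernel_dist_shrikhandeGraph using 1
    norm_num
  have hconn : shrikhandeGraph.Connected :=
    ⟨fun x y => (dist_shrikhandeGraph x y).1⟩
  convert (h.pi s).prod (isQuadraticKernel_dist_hammingGraph (d := t) (q := 4) (by norm_num))
    using 3 with x y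
  have hx := dist_cartesianPower hconn x.1 y.1
  rw [doobGraph, dist_boxProd hx.1 (dist_hammingGraph x.2 y.2).1, hx.2]
  push_cast
  rfl


/-! ### Kernels from Gram matrices -/

/-- A kernel `c - s M Mᵀ`, where the Gram matrix of the columns of `M` is a combination of the
identity and the all-ones matrix. -/
theorem isQuadraticKernel_of_gram {V ι : Type*} [Fintype V] [Fintype ι] [DecidableEq ι]
    {M : V → ι → ℝ} {a b m e f : ℝ} (c s : ℝ)
    (hM : ∀ i j, ∑ x, M x i * M x j = a * (if i = j then 1 else 0) + b)
    (hm : ∀ i, ∑ x, M x i = m) (he : ∀ x, m * ∑ i, M x i = e)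
    (hf : ∀ x y, b * (∑ i, M x i) * ∑ i, M y i = f) :
    IsQuadraticKernel (s * a) fun x y => c - s * ∑ i, M x i * M y i := by
  -- Only the products with `m` and `b` need be constant: the sign vectors of the halved cube have
  -- varying coordinate sums, but there `m = b = 0`.
  have hrow : ∀ x, ∑ z, ∑ i, M x i * M z i = e := fun x => by
    rw [Finset.sum_comm, ← he x, Finset.mul_sum]
    refine Finset.sum_congr rfl fun i _ => ?_
    rw [← Finset.mul_sum, hm, mul_comm]
  have hcol : ∀ y, ∑ z, ∑ i, M z i * M y i = e := fun y => by
    simpa only [mul_comm] using hrow y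
  -- `(MMᵀ)² = M(MᵀM)Mᵀ = a MMᵀ + b(M1)(M1)ᵀ`, and the last term is `fJ`.
  have hsq : ∀ x y, ∑ z, (∑ i, M x i * M z i) * (∑ j, M z j * M y j) =
      a * ∑ i, M x i * M y i + f := fun x y => by
    calc _ = ∑ i, ∑ j, M x i * M y j * ∑ z, M z i * M z j := by
          simp only [Finset.sum_mul_sum]
          simp only [Finset.mul_sum]
          rw [Finset.sum_comm]
          refine Finset.sum_congr rfl fun i _ => ?_
          rw [Finset.sum_comm]
          exact Finset.sum_congr rfl fun j _ => Finset.sum_congr rfl fun z _ => by ring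
      _ = a * ∑ i, M x i * M y i + b * (∑ i, M x i) * ∑ i, M y i := by
          simp only [hM, mul_add, Finset.sum_add_distrib, mul_ite, mul_one, mul_zero,
            Finset.sum_ite_eq, Finset.mem_univ, if_true]
          congr 1
          · rw [Finset.mul_sum]
            exact Finset.sum_congr rfl fun i _ => by ring
          · rw [mul_assoc, Finset.sum_mul_sum, Finset.mul_sum]
            refine Finset.sum_congr rfl fun i _ => ?_
            rw [Finset.mul_sum]
            exact Finset.sum_congr rfl fun j _ => by ring
      _ = _ := by rw [hf]
  refine ⟨fun x y => by simp only [mul_comm], ⟨Fintype.card V * c - s * e, fun x => ?_⟩,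
    Fintype.card V * c ^ 2 - 2 * (c * s * e) + s ^ 2 * f + s * a * c, fun x y => ?_⟩
  · simp only [Finset.sum_sub_distrib, ← Finset.mul_sum, hrow, Finset.sum_const, Finset.card_univ,
      nsmul_eq_mul]
  · have h : ∀ z, (c - s * ∑ i, M x i * M z i) * (c - s * ∑ i, M z i * M y i) =
        c ^ 2 - c * s * (∑ i, M x i * M z i) - c * s * (∑ i, M z i * M y i) +
          s ^ 2 * ((∑ i, M x i * M z i) * ∑ i, M z i * M y i) := fun z => by ring
    simp only [h, Finset.sum_sub_distrib, Finset.sum_add_distrib, ← Finset.mul_sum, hrow, hcol,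
      hsq, Finset.sum_const, Finset.card_univ, nsmul_eq_mul]
    ring

/-- The symmetric group is transitive on points and on ordered pairs of distinct points. -/
theorem exists_eq_ite_of_perm_invariant {ι : Type*} [DecidableEq ι] {P : ι → ι → ℝ}
    (hP : ∀ (σ : Equiv.Perm ι) i j, P (σ i) (σ j) = P i j) :
    ∃ d b, ∀ i j, P i j = if i = j then d else b := by
  rcases subsingleton_or_nontrivial ι with h | ⟨i, j, hij⟩
  · rcases isEmpty_or_nonempty ι with h' | ⟨⟨i⟩⟩
    · exact ⟨0, 0, fun i => h'.elim i⟩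
    · exact ⟨P i i, 0, fun j k => by
        rw [Subsingleton.elim j i, Subsingleton.elim k i, if_pos rfl]⟩
  · refine ⟨P i i, P i j, fun i' j' => ?_⟩
    split_ifs with h
    · subst h
      simpa using hP (Equiv.swap i i') i i
    · have h1 : Equiv.swap i i' j ≠ i' := fun h2 =>
        hij ((Equiv.swap i i').injective (by rw [h2, Equiv.swap_apply_left]))
      have := hP (Equiv.swap (Equiv.swap i i' j) j' * Equiv.swap i i') i j
      rwa [Equiv.Perm.mul_apply, Equiv.Perm.mul_apply, Equiv.swap_apply_left,
        Equiv.swap_apply_left, Equiv.swap_apply_of_ne_of_ne h1.symm h] at this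

/-! ### Subsets of fixed size: Johnson graphs -/

/-- The inclusion matrix of elements in `k`-subsets. -/
def inclusion {n k : ℕ} (S : {S : Finset (Fin n) // S.card = k}) (i : Fin n) : ℝ :=
  if i ∈ S.1 then 1 else 0

theorem sum_inclusion {n k : ℕ} (S : {S : Finset (Fin n) // S.card = k}) :
    ∑ i, inclusion S i = k := by
  simp [inclusion, S.2]

theorem sum_inclusion_mul_inclusion {n k : ℕ} (S T : {S : Finset (Fin n) // S.card = k}) :
    ∑ i, inclusion S i * inclusion T i = ((S.1 ∩ T.1).card : ℝ) := by
  simp only [inclusion, ← ite_and, mul_ite, mul_one, mul_zero]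
  rw [Finset.sum_boole]
  congr 2
  ext i
  simp [and_comm]

/-- Permutation invariance gives the shape without binomial coefficients. For `i ≠ j`, `a` counts
the `k`-subsets containing `i` but not `j`, so a single such subset makes it positive. -/
theorem inclusion_gram (n k : ℕ) : ∃ a b m : ℝ,
    (∀ i j, ∑ S : {S : Finset (Fin n) // S.card = k}, inclusion S i * inclusion S j =
      a * (if i = j then 1 else 0) + b) ∧
    (∀ i, ∑ S : {S : Finset (Fin n) // S.card = k}, inclusion S i = m) ∧
    ∀ (S : {S : Finset (Fin n) // S.card = k}) (i j : Fin n), i ∈ S.1 → j ∉ S.1 → 0 < a := by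
  obtain ⟨d, b, h⟩ := exists_eq_ite_of_perm_invariant
    (P := fun i j => ∑ S : {S : Finset (Fin n) // S.card = k}, inclusion S i * inclusion S j)
    (fun σ i j => by
      let e : {S : Finset (Fin n) // S.card = k} ≃ {S : Finset (Fin n) // S.card = k} :=
        σ.finsetCongr.subtypeEquiv fun S => by simp
      rw [← e.sum_comp]
      simp [inclusion, e, Equiv.subtypeEquiv_apply])
  refine ⟨d - b, b, d, fun i j => ?_, fun i => ?_, fun S i j hi hj => ?_⟩
  · rw [h]; split_ifs <;> ring
  · have := h i i
    rw [if_pos rfl] at this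
    rw [← this]
    refine Finset.sum_congr rfl fun S _ => ?_
    simp [inclusion]
  · have hij : i ≠ j := by rintro rfl; exact hj hi
    have h1 := h i i
    have h2 := h i j
    rw [if_pos rfl] at h1
    rw [if_neg hij] at h2
    rw [← h1, ← h2, ← Finset.sum_sub_distrib]
    refine Finset.sum_pos' (fun T _ => ?_) ⟨S, Finset.mem_univ _, ?_⟩
    · unfold inclusion; split_ifs <;> norm_num
    · simp [inclusion, hi, hj]

theorem exists_mem_notMem_of_card_eq {α : Type*} [DecidableEq α] {S T : Finset α}
    (h : S.card = T.card) (hne : S ≠ T) : ∃ i, i ∈ S ∧ i ∉ T := by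
  by_contra hc
  push Not at hc
  exact hne (Finset.eq_of_subset_of_card_le hc h.ge)

/-- Trading `j` for `i` in `T` is one step in the Johnson graph; its effect on `S ∩ T` provides the
geodesic steps for Johnson and Gosset graphs. -/
theorem card_exchange {α : Type*} [DecidableEq α] {T : Finset α} {i j : α} (hi : i ∉ T)
    (hj : j ∈ T) : (insert i (T.erase j)).card = T.card ∧
      (insert i (T.erase j) ∩ T).card + 1 = T.card ∧
      ∀ S : Finset α, (i ∈ S → j ∉ S → (S ∩ insert i (T.erase j)).card = (S ∩ T).card + 1) ∧
        (i ∉ S → j ∈ S → (S ∩ insert i (T.erase j)).card + 1 = (S ∩ T).card) := by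
  have hpos : 0 < T.card := Finset.card_pos.2 ⟨j, hj⟩
  refine ⟨?_, ?_, fun S => ⟨fun h1 h2 => ?_, fun h1 h2 => ?_⟩⟩
  · rw [Finset.card_insert_of_notMem (by simp [hi]), Finset.card_erase_of_mem hj]
    omega
  · rw [Finset.insert_inter_of_notMem hi, Finset.inter_eq_left.2 (Finset.erase_subset _ _),
      Finset.card_erase_of_mem hj]
    omega
  · rw [Finset.inter_insert_of_mem h1, Finset.inter_erase,
      Finset.erase_eq_of_notMem (by simp [h2]), Finset.card_insert_of_notMem (by simp [hi])]
  · have : 0 < (S ∩ T).card := Finset.card_pos.2 ⟨j, Finset.mem_inter.2 ⟨h2, hj⟩⟩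
    rw [Finset.inter_insert_of_notMem h1, Finset.inter_erase,
      Finset.card_erase_of_mem (Finset.mem_inter.2 ⟨h2, hj⟩)]
    omega

/-- Among `k`-subsets this is the triangle inequality for `k - |S ∩ T|`. Both `S ∩ T` and `T ∩ U`
lie in `T`, and they meet inside `S ∩ U`. -/
theorem card_inter_add_card_inter_le {α : Type*} [DecidableEq α] (S T U : Finset α) :
    (S ∩ T).card + (T ∩ U).card ≤ (S ∩ U).card + T.card := by
  have h1 : (S ∩ T) ∩ (T ∩ U) ⊆ S ∩ U := fun i hi => by
    simp only [Finset.mem_inter] at hi ⊢; tauto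
  have h2 : (S ∩ T) ∪ (T ∩ U) ⊆ T := fun i hi => by
    simp only [Finset.mem_inter, Finset.mem_union] at hi; tauto
  have := Finset.card_union_add_card_inter (S ∩ T) (T ∩ U)
  have := Finset.card_le_card h1
  have := Finset.card_le_card h2
  omega

theorem card_inter_le_of_card_eq {α : Type*} [DecidableEq α] {S : Finset α} {k : ℕ}
    (hS : S.card = k) (T : Finset α) : (S ∩ T).card ≤ k :=
  hS ▸ Finset.card_le_card Finset.inter_subset_left

theorem dist_johnsonGraph {n k : ℕ} (S T : {S : Finset (Fin n) // S.card = k}) :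
    (johnsonGraph n k).dist S T = k - (S.1 ∩ T.1).card := by
  refine (reachable_and_dist_eq
    (fun S T : {S : Finset (Fin n) // S.card = k} => k - (S.1 ∩ T.1).card)
    (fun S => by simp [S.2]) (fun S T U h => ?_) (fun S T h => ?_) S T).2
  · have h' : (T.1 ∩ U.1).card + 1 = k := h
    have := card_inter_add_card_inter_le S.1 T.1 U.1
    have := T.2
    change k - (S.1 ∩ U.1).card ≤ k - (S.1 ∩ T.1).card + 1
    omega
  · have h' : S.1 ≠ T.1 := fun h' => h (Subtype.ext h')
    obtain ⟨i, hiS, hiT⟩ := exists_mem_notMem_of_card_eq (S.2.trans T.2.symm) h'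
    obtain ⟨j, hjT, hjS⟩ := exists_mem_notMem_of_card_eq (T.2.trans S.2.symm) h'.symm
    obtain ⟨h1, h2, h3⟩ := card_exchange hiT hjT
    refine ⟨⟨insert i (T.1.erase j), h1.trans T.2⟩, h2.trans T.2, ?_⟩
    change k - (S.1 ∩ insert i (T.1.erase j)).card + 1 = k - (S.1 ∩ T.1).card
    have := (h3 S.1).1 hiS hjS
    have := card_inter_le_of_card_eq S.2 (insert i (T.1.erase j))
    omega

theorem isQuadraticKernel_dist_johnsonGraph {n k : ℕ}
    [Nontrivial {S : Finset (Fin n) // S.card = k}] :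
    ∃ θ : ℝ, 0 < θ ∧ IsQuadraticKernel θ fun S T => ((johnsonGraph n k).dist S T : ℝ) := by
  obtain ⟨a, b, m, hM, hm, ha⟩ := inclusion_gram n k
  obtain ⟨S, T, hST⟩ := exists_pair_ne {S : Finset (Fin n) // S.card = k}
  have hST' : S.1 ≠ T.1 := fun h' => hST (Subtype.ext h')
  obtain ⟨i, hiS, hiT⟩ := exists_mem_notMem_of_card_eq (S.2.trans T.2.symm) hST'
  obtain ⟨j, hjT, hjS⟩ := exists_mem_notMem_of_card_eq (T.2.trans S.2.symm) hST'.symm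
  refine ⟨1 * a, by simpa using ha S i j hiS hjS, ?_⟩
  convert isQuadraticKernel_of_gram (k : ℝ) 1 hM hm (fun S => by rw [sum_inclusion])
    (fun S T => by rw [sum_inclusion, sum_inclusion]) using 3 with S T
  rw [dist_johnsonGraph, sum_inclusion_mul_inclusion, one_mul,
    Nat.cast_sub (card_inter_le_of_card_eq S.2 _)]

/-! ### The Gosset graph -/

/-- The distance function of the Gosset graph. -/
def gossetDist (u v : Bool × {e : Finset (Fin 8) // e.card = 2}) : ℕ :=
  if u.1 = v.1 then 2 - (u.2.1 ∩ v.2.1).card else 1 + (u.2.1 ∩ v.2.1).card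

theorem card_inter_add_card_inter_le_of_disjoint {α : Type*} [DecidableEq α] {S T U : Finset α}
    (h : Disjoint T U) : (S ∩ T).card + (S ∩ U).card ≤ S.card := by
  rw [← Finset.card_union_of_disjoint
    (h.mono Finset.inter_subset_right Finset.inter_subset_right)]
  exact Finset.card_le_card
    (Finset.union_subset Finset.inter_subset_left Finset.inter_subset_left)

theorem dist_gossetGraph (u v : Bool × {e : Finset (Fin 8) // e.card = 2}) :
    gossetGraph.dist u v = gossetDist u v := by
  refine (reachable_and_dist_eq gossetDist (fun u => by simp [gossetDist, u.2.2])
    (fun u v w h => ?_) (fun u v h => ?_) u v).2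
  · obtain ⟨s, S⟩ := u
    obtain ⟨t, T⟩ := v
    obtain ⟨r, U⟩ := w
    have hS := S.2
    have hT := T.2
    have hU := U.2
    rcases h with ⟨h, h'⟩ | ⟨h, h'⟩
    · have h1 := card_inter_add_card_inter_le S.1 T.1 U.1
      have h2 := card_inter_add_card_inter_le S.1 U.1 T.1
      rw [Finset.inter_comm U.1] at h2
      simp only [gossetDist] at h h' ⊢
      subst h
      split_ifs <;> omega
    · have h1 := card_inter_add_card_inter_le_of_disjoint (S := S.1) h'
      have h2 := card_inter_le_of_card_eq hS T.1
      have h3 := card_inter_le_of_card_eq hS U.1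
      simp only [gossetDist] at h h1 ⊢
      have : ¬ (s = t ∧ s = r) := fun hc => h (hc.1.symm.trans hc.2)
      have : s = t ∨ s = r := by revert h; cases s <;> cases t <;> cases r <;> simp
      split_ifs <;> first | omega | tauto
  · obtain ⟨s, S⟩ := u
    obtain ⟨t, T⟩ := v
    by_cases hst : s = t
    · subst hst
      have h' : S.1 ≠ T.1 := fun h' => h (Prod.ext rfl (Subtype.ext h'))
      obtain ⟨i, hiS, hiT⟩ := exists_mem_notMem_of_card_eq (S.2.trans T.2.symm) h'
      obtain ⟨j, hjT, hjS⟩ := exists_mem_notMem_of_card_eq (T.2.trans S.2.symm) h'.symm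
      obtain ⟨h1, h2, h3⟩ := card_exchange hiT hjT
      have h4 := (h3 S.1).1 hiS hjS
      have h5 := card_inter_le_of_card_eq S.2 (insert i (T.1.erase j))
      have hT := T.2
      refine ⟨(s, ⟨insert i (T.1.erase j), h1.trans T.2⟩), Or.inl ⟨rfl, ?_⟩, ?_⟩
      · simp only; omega
      · simp only [gossetDist, if_true]; omega
    · rcases Finset.eq_empty_or_nonempty (S.1 ∩ T.1) with h0 | ⟨j, hj⟩
      · refine ⟨(s, S), Or.inr ⟨hst, Finset.disjoint_iff_inter_eq_empty.2 h0⟩, ?_⟩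
        simp [gossetDist, hst, h0, S.2]
      · rw [Finset.mem_inter] at hj
        -- Two edges cover at most 4 of the 8 points; trading the common point `j` for an uncovered
        -- one shrinks the intersection.
        obtain ⟨i, hi⟩ : ∃ i, i ∉ S.1 ∪ T.1 := by
          by_contra hc
          push Not at hc
          have h1 := Finset.card_le_card fun i (_ : i ∈ Finset.univ) => hc i
          have h2 := Finset.card_union_le S.1 T.1
          rw [Finset.card_univ, Fintype.card_fin] at h1
          have := S.2
          have := T.2
          omega
        rw [Finset.mem_union, not_or] at hi
        obtain ⟨h1, h2, h3⟩ := card_exchange hi.2 hj.2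
        have h4 := (h3 S.1).2 hi.1 hj.1
        have hT := T.2
        refine ⟨(t, ⟨insert i (T.1.erase j), h1.trans T.2⟩), Or.inl ⟨rfl, ?_⟩, ?_⟩
        · simp only; omega
        · simp only [gossetDist, hst, if_false]; omega

theorem isQuadraticKernel_dist_gossetGraph :
    ∃ θ : ℝ, 0 < θ ∧ IsQuadraticKernel θ fun u v => (gossetGraph.dist u v : ℝ) := by
  obtain ⟨a, b, m, hM, hm, ha⟩ := inclusion_gram 8 2
  have hapos : 0 < a := ha ⟨{0, 1}, rfl⟩ 0 2 (by decide) (by decide)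
  have hcard : Fintype.card {e : Finset (Fin 8) // e.card = 2} = 28 := by
    rw [Fintype.card_finset_len]; decide
  -- Coordinates sum to `4·2 - 8 = 0`, and column sums cancel between the copies. Inner products are
  -- `±(16|e ∩ f| - 8)`, so `3/2 - (1/16)⟨·,·⟩` is `2 - |e ∩ f|` within a copy and `1 + |e ∩ f|`
  -- across.
  let M : Bool × {e : Finset (Fin 8) // e.card = 2} → Fin 8 → ℝ := fun u i =>
    (if u.1 then 1 else -1) * (4 * inclusion u.2 i - 1)
  have hgram : ∀ i j, ∑ x, M x i * M x j =
      32 * a * (if i = j then 1 else 0) + (32 * b - 16 * m + 56) := fun i j => by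
    have h : ∀ e : {e : Finset (Fin 8) // e.card = 2},
        (4 * inclusion e i - 1) * (4 * inclusion e j - 1) =
          16 * (inclusion e i * inclusion e j) - 4 * inclusion e i - 4 * inclusion e j + 1 :=
      fun e => by ring
    simp only [M, Fintype.sum_prod_type, Fintype.sum_bool, if_true, Bool.false_eq_true, if_false,
      one_mul, neg_mul, mul_neg, neg_neg, h, Finset.sum_add_distrib, Finset.sum_sub_distrib,
      ← Finset.mul_sum, hM, hm, Finset.sum_const, Finset.card_univ, hcard, nsmul_eq_mul]
    push_cast
    ring
  have hsum : ∀ i, ∑ x, M x i = 0 := fun i => by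
    simp [M, Fintype.sum_prod_type]
  have hrow : ∀ x, ∑ i, M x i = 0 := fun x => by
    simp only [M, ← Finset.mul_sum, Finset.sum_sub_distrib, sum_inclusion]
    norm_num
  refine ⟨1 / 16 * (32 * a), by positivity, ?_⟩
  convert isQuadraticKernel_of_gram (e := 0) (f := 0) (3 / 2 : ℝ) (1 / 16) hgram hsum
    (fun x => by rw [zero_mul]) (fun x y => by rw [hrow y, mul_zero]) using 3 with x y
  have h : ∑ i, M x i * M y i =
      (if x.1 then 1 else -1) * (if y.1 then 1 else -1) * (16 * ((x.2.1 ∩ y.2.1).card : ℝ) - 8) := by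
    have h : ∀ i, M x i * M y i = (if x.1 then 1 else -1) * (if y.1 then 1 else -1) *
        (16 * (inclusion x.2 i * inclusion y.2 i) - 4 * inclusion x.2 i - 4 * inclusion y.2 i + 1) :=
      fun i => by simp only [M]; ring
    simp only [h, ← Finset.mul_sum, Finset.sum_add_distrib, Finset.sum_sub_distrib, sum_inclusion,
      sum_inclusion_mul_inclusion, Finset.sum_const, Finset.card_univ, Fintype.card_fin]
    norm_num
  have hle := card_inter_le_of_card_eq x.2.2 y.2.1
  rw [dist_gossetGraph, h, gossetDist]
  obtain ⟨s, S⟩ := x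
  obtain ⟨t, T⟩ := y
  cases s <;> cases t <;> simp at hle ⊢ <;> (try rw [Nat.cast_sub hle]) <;> push_cast <;> ring

/-! ### Halved cubes -/

theorem natCast_hammingNorm {n : ℕ} (x : Fin n → ZMod 2) :
    (hammingNorm x : ZMod 2) = ∑ i, x i := by
  rw [hammingNorm, Finset.card_filter, Nat.cast_sum]
  refine Finset.sum_congr rfl fun i _ => ?_
  generalize x i = a
  revert a
  decide

theorem even_hammingNorm_iff {n : ℕ} (x : Fin n → ZMod 2) :
    Even (hammingNorm x) ↔ ∑ i, x i = 0 := by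
  rw [← natCast_hammingNorm, ZMod.natCast_eq_zero_iff_even]

theorem two_dvd_hammingDist {n : ℕ} (x y : {x : Fin n → ZMod 2 // Even (hammingNorm x)}) :
    2 ∣ hammingDist x.1 y.1 := by
  rw [← even_iff_two_dvd, hammingDist_eq_hammingNorm, even_hammingNorm_iff]
  simp [Finset.sum_add_distrib, (even_hammingNorm_iff _).1 x.2, (even_hammingNorm_iff _).1 y.2]

/-- Change two letters of a binary word. -/
def flipTwo {n : ℕ} (i j : Fin n) (x : Fin n → ZMod 2) : Fin n → ZMod 2 :=
  x + (Pi.single i 1 + Pi.single j 1)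

theorem flipTwo_apply {n : ℕ} {i j : Fin n} (hij : i ≠ j) (x : Fin n → ZMod 2) (l : Fin n) :
    flipTwo i j x l = if l = i ∨ l = j then x l + 1 else x l := by
  by_cases hi : l = i
  · subst hi; simp [flipTwo, hij]
  · by_cases hj : l = j
    · subst hj; simp [flipTwo, hij.symm]
    · simp [flipTwo, hi, hj]

theorem even_hammingNorm_flipTwo {n : ℕ} {i j : Fin n} {x : Fin n → ZMod 2}
    (hx : Even (hammingNorm x)) : Even (hammingNorm (flipTwo i j x)) := by
  rw [even_hammingNorm_iff] at hx ⊢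
  simp only [flipTwo, Pi.add_apply, Finset.sum_add_distrib, hx, Finset.sum_pi_single',
    Finset.mem_univ, if_true]
  simp
  decide

theorem dist_halvedCube {n : ℕ} (x y : {x : Fin n → ZMod 2 // Even (hammingNorm x)}) :
    (halvedCube n).dist x y = hammingDist x.1 y.1 / 2 := by
  refine (reachable_and_dist_eq
    (fun x y : {x : Fin n → ZMod 2 // Even (hammingNorm x)} => hammingDist x.1 y.1 / 2)
    (fun x => by simp) (fun x y z h => ?_) (fun x y h => ?_) x y).2
  · have h' : hammingDist y.1 z.1 = 2 := h
    have := hammingDist_triangle x.1 y.1 z.1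
    change hammingDist x.1 z.1 / 2 ≤ hammingDist x.1 y.1 / 2 + 1
    omega
  · have hne : ∀ a b : ZMod 2, a ≠ b → a = b + 1 := by decide
    have hpos : 0 < hammingDist x.1 y.1 := hammingDist_pos.2 fun h' => h (Subtype.ext h')
    have h2 := two_dvd_hammingDist x y
    obtain ⟨i, hi, j, hj, hij⟩ := Finset.one_lt_card.1
      (show 1 < (Finset.univ.filter fun i => x.1 i ≠ y.1 i).card by
        change 1 < hammingDist x.1 y.1
        omega)
    simp only [Finset.mem_filter, Finset.mem_univ, true_and] at hi hj
    have hd : hammingDist (flipTwo i j y.1) y.1 = 2 := by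
      refine Eq.trans (congrArg Finset.card ?_) (Finset.card_pair hij)
      ext l
      simp only [Finset.mem_filter, Finset.mem_univ, true_and, flipTwo_apply hij,
        Finset.mem_insert, Finset.mem_singleton]
      split_ifs with hl <;> simp [hl]
    refine ⟨⟨flipTwo i j y.1, even_hammingNorm_flipTwo y.2⟩, hd, ?_⟩
    have hcard : hammingDist x.1 y.1 = hammingDist x.1 (flipTwo i j y.1) + 2 := by
      have hset : (Finset.univ.filter fun l => x.1 l ≠ y.1 l) =
          (Finset.univ.filter fun l => x.1 l ≠ flipTwo i j y.1 l) ∪ {i, j} := by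
        ext l
        simp only [Finset.mem_filter, Finset.mem_univ, true_and, Finset.mem_union,
          flipTwo_apply hij, Finset.mem_insert, Finset.mem_singleton]
        split_ifs with hl
        · simp only [hl, or_true, iff_true]
          rcases hl with rfl | rfl <;> assumption
        · simp [hl]
      unfold hammingDist
      rw [hset, Finset.card_union_of_disjoint, Finset.card_pair hij]
      rw [Finset.disjoint_left]
      intro l hl hl'
      simp only [Finset.mem_filter, Finset.mem_univ, true_and, flipTwo_apply hij] at hl
      simp only [Finset.mem_insert, Finset.mem_singleton] at hl'
      rw [if_pos hl'] at hl
      rcases hl' with rfl | rfl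
      · exact hl (hne _ _ hi)
      · exact hl (hne _ _ hj)
    change hammingDist x.1 (flipTwo i j y.1) / 2 + 1 = hammingDist x.1 y.1 / 2
    omega

/-- The nontrivial character of `ZMod 2`. -/
def signChar (a : ZMod 2) : ℝ := if a = 0 then 1 else -1

theorem signChar_add_one (a : ZMod 2) : signChar (a + 1) = -signChar a := by
  have h : ∀ a : ZMod 2, (a + 1 = 0 ∧ a ≠ 0) ∨ (a + 1 ≠ 0 ∧ a = 0) := by decide
  rcases h a with ⟨h1, h2⟩ | ⟨h1, h2⟩ <;> simp [signChar, h1, h2]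

theorem signChar_mul_signChar (a b : ZMod 2) :
    signChar a * signChar b = 1 - 2 * if a ≠ b then 1 else 0 := by
  have h : ∀ a b : ZMod 2, (a = 0 ∧ b = 0) ∨ (a = 0 ∧ b = 1) ∨ (a = 1 ∧ b = 0) ∨
    (a = 1 ∧ b = 1) := by decide
  rcases h a b with ⟨rfl, rfl⟩ | ⟨rfl, rfl⟩ | ⟨rfl, rfl⟩ | ⟨rfl, rfl⟩ <;> norm_num [signChar]

theorem flipTwo_flipTwo {n : ℕ} (i j : Fin n) (x : Fin n → ZMod 2) :
    flipTwo i j (flipTwo i j x) = x := by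
  rw [flipTwo, flipTwo, add_assoc]
  convert add_zero x using 2
  ext l
  exact CharTwo.add_self_eq_zero ((Pi.single i 1 + Pi.single j 1 : Fin n → ZMod 2) l)

/-- Flipping two letters preserves even weight, so it is a sign-reversing involution of the index
set. -/
theorem sum_eq_zero_of_flipTwo {n : ℕ} {i j : Fin n} {F : (Fin n → ZMod 2) → ℝ}
    (hF : ∀ x, F (flipTwo i j x) = -F x) :
    ∑ x : {x : Fin n → ZMod 2 // Even (hammingNorm x)}, F x.1 = 0 := by
  let e : Equiv.Perm {x : Fin n → ZMod 2 // Even (hammingNorm x)} :=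
    Function.Involutive.toPerm (fun x : {x : Fin n → ZMod 2 // Even (hammingNorm x)} =>
      ⟨flipTwo i j x.1, even_hammingNorm_flipTwo x.2⟩) fun x => Subtype.ext (flipTwo_flipTwo i j x.1)
  have h := Equiv.sum_comp e fun x : {x : Fin n → ZMod 2 // Even (hammingNorm x)} => F x.1
  have h' : ∀ x : {x : Fin n → ZMod 2 // Even (hammingNorm x)}, F (e x).1 = -F x.1 := fun x => hF x.1
  simp only [h', Finset.sum_neg_distrib] at h
  linarith

theorem exists_ne_ne {n : ℕ} (hn : 3 ≤ n) (i j : Fin n) : ∃ l, l ≠ i ∧ l ≠ j := by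
  by_contra hc
  push Not at hc
  have h1 : (Finset.univ : Finset (Fin n)) ⊆ {i, j} := fun l _ => by
    by_cases hl : l = i
    · simp [hl]
    · simp [hc l hl]
  have h2 := Finset.card_le_card h1
  have h3 := Finset.card_le_two (a := i) (b := j)
  rw [Finset.card_univ, Fintype.card_fin] at h2
  omega

theorem isQuadraticKernel_dist_halvedCube {n : ℕ} (hn : 3 ≤ n) :
    IsQuadraticKernel
      (1 / 4 * (Fintype.card {x : Fin n → ZMod 2 // Even (hammingNorm x)} : ℝ))
      fun x y => ((halvedCube n).dist x y : ℝ) := by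
  have hgram : ∀ i j, ∑ x : {x : Fin n → ZMod 2 // Even (hammingNorm x)},
      signChar (x.1 i) * signChar (x.1 j) =
      (Fintype.card {x : Fin n → ZMod 2 // Even (hammingNorm x)} : ℝ) *
        (if i = j then 1 else 0) + 0 := fun i j => by
    by_cases hij : i = j
    · subst hij
      simp [signChar_mul_signChar]
    -- Flipping `i` and a third position `l` negates the sign at `i` only. For `n = 2` the two
    -- columns would coincide on even words.
    · obtain ⟨l, hli, hlj⟩ := exists_ne_ne hn i j
      rw [if_neg hij, mul_zero, add_zero]
      refine sum_eq_zero_of_flipTwo (i := i) (j := l)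
        (F := fun x => signChar (x i) * signChar (x j)) fun x => ?_
      simp only [flipTwo_apply hli.symm, true_or, if_true, signChar_add_one]
      rw [if_neg (by tauto), neg_mul]
  have hsum : ∀ i, ∑ x : {x : Fin n → ZMod 2 // Even (hammingNorm x)}, signChar (x.1 i) = 0 :=
    fun i => by
      obtain ⟨l, hli, -⟩ := exists_ne_ne hn i i
      refine sum_eq_zero_of_flipTwo (i := i) (j := l) (F := fun x => signChar (x i)) fun x => ?_
      simp only [flipTwo_apply hli.symm, true_or, if_true, signChar_add_one]
  -- Sign vectors at Hamming distance `h` have inner product `n - 2h`, so `h/2 = n/4 - (1/4)(n -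
  -- 2h)`.
  convert isQuadraticKernel_of_gram (e := 0) (f := 0) (n / 4 : ℝ) (1 / 4) hgram hsum
    (fun x => by rw [zero_mul]) (fun x y => by rw [zero_mul, zero_mul]) using 3 with x y
  rw [dist_halvedCube, Nat.cast_div (two_dvd_hammingDist x y) (by norm_num)]
  simp only [signChar_mul_signChar, Finset.sum_sub_distrib, ← Finset.mul_sum, Finset.sum_boole,
    Finset.sum_const, Finset.card_univ, Fintype.card_fin, nsmul_eq_mul, hammingDist]
  push_cast
  ring

end DistanceSpectra

/-! ### The five families together -/

theorem mainTheorem3 {V : Type*} [Fintype V] (Γ : SimpleGraph V)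
    (hΓ : (DistanceSpectra.IsHammingGraph Γ ∨ DistanceSpectra.IsDoobGraph Γ) ∨
      DistanceSpectra.IsJohnsonGraph Γ ∨
      DistanceSpectra.IsHalvedCube Γ ∨
      DistanceSpectra.IsGossetGraph Γ)
    (hD : 3 ≤ Γ.diam) :
    (DistanceSpectra.distanceEigenvalues Γ).ncard = 3 ∧
      (0 : ℝ) ∈ DistanceSpectra.distanceEigenvalues Γ := by
  have hV : Nontrivial V := SimpleGraph.nontrivial_of_diam_ne_zero (G := Γ) (by omega)
  obtain ⟨a, b, hab⟩ := Γ.exists_dist_eq_diam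
  rcases hΓ with (⟨d, q, ⟨e⟩⟩ | ⟨s, t, -, ⟨e⟩⟩) | ⟨n, k, ⟨e⟩⟩ | ⟨n, ⟨e⟩⟩ | ⟨⟨e⟩⟩
  · have hW : Nontrivial (Fin d → Fin q) := e.symm.toEquiv.nontrivial
    obtain ⟨x, y, hxy⟩ := exists_pair_ne (Fin d → Fin q)
    obtain ⟨i, -⟩ := Function.ne_iff.1 hxy
    have hq : 0 < q := (x i).pos
    refine (DistanceSpectra.isQuadraticKernel_dist_hammingGraph
      hq.ne').ncard_distanceEigenvalues_of_iso e ?_ hD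
    have : 0 < Fintype.card (Fin d → Fin q) := Fintype.card_pos
    positivity
  · have hW : Nontrivial ((Fin s → ZMod 4 × ZMod 4) × (Fin t → Fin 4)) :=
      e.symm.toEquiv.nontrivial
    refine (DistanceSpectra.isQuadraticKernel_dist_doobGraph
      s t).ncard_distanceEigenvalues_of_iso e ?_ hD
    have : 0 < Fintype.card ((Fin s → ZMod 4 × ZMod 4) × (Fin t → Fin 4)) := Fintype.card_pos
    positivity
  · have hW : Nontrivial {S : Finset (Fin n) // S.card = k} := e.symm.toEquiv.nontrivial
    obtain ⟨θ, hθ, h⟩ := DistanceSpectra.isQuadraticKernel_dist_johnsonGraph (n := n) (k := k)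
    exact h.ncard_distanceEigenvalues_of_iso e hθ hD
  -- A diameter is half a Hamming distance, hence at most `n/2`.
  · have hn : 3 ≤ n := by
      have h1 := DistanceSpectra.dist_halvedCube (e a) (e b)
      have h2 : hammingDist (e a).1 (e b).1 ≤ Fintype.card (Fin n) := hammingDist_le_card_fintype
      rw [DistanceSpectra.dist_apply_iso] at h1
      rw [Fintype.card_fin] at h2
      omega
    refine (DistanceSpectra.isQuadraticKernel_dist_halvedCube
      hn).ncard_distanceEigenvalues_of_iso e ?_ hD
    have : 0 < Fintype.card {x : Fin n → ZMod 2 // Even (hammingNorm x)} :=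
      Fintype.card_pos_iff.2 ⟨e a⟩
    positivity
  · obtain ⟨θ, hθ, h⟩ := DistanceSpectra.isQuadraticKernel_dist_gossetGraph
    exact h.ncard_distanceEigenvalues_of_iso e hθ hD
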